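/- **Effective complexity and depth with constraints.** *Conventions.* Let $V$ be a universal (plain) computer, realized as a Turing machine, and let $T(p)$ be its halting time on input $p\in\{0,1\}^*$; put $C(x)=\min\{\ell(p) : V(p)=x\}$ and ${\rm Depth}_z(x)=\min\{T(p) : \ell(p)-C(x)\le z,\ V(p)=x\}$. Let $U$ be a universal prefix computer (its programs may receive an additional input, and for each fixed input its set of halting programs is prefix-free); put $K(a)=\min\{\ell(p) : U(p)=a\}$ for a string or integer $a$. For a computable $f:\mathbb N\to\mathbb N$, $K(f)$ is the length of a shortest program for $U$ that computes $f(n)$ from every input $n$. An *ensemble* $\mathbb E$ is a computable probability distribution on $\{0,1\}^*$ whose entropy $H(\mathbb E)=-\sum_x\mathbb E(x)\log_2\mathbb E(x)$ is finite and computable; $K(\mathbb E)$ is the length of a shortest program for $U$ that computes, to any requested accuracy $2^{-n}$, the probability $\mathbb E(s)$ of any given string $s$ and the entropy $H(\mathbb E)$. Put $\Sigma(\mathbb E)=K(\mathbb E)+H(\mathbb E)$. A set $\mathcal C$ of ensembles is *convex* if every computable convex combination (again an ensemble) of finitely many elements of $\mathcal C$ lies in $\mathcal C$, and *decidable* if some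 algorithm decides, given a string $s$, whether the Dirac measure $\delta_s$ lies in $\mathcal C$; $K(\mathcal C)$ is then the length of a shortest program for $U$ that computes this decision function. For $\delta,\Delta\ge 0$, $$\mathcal E_{\delta,\Delta}(x|\mathcal C)=\inf\{K(\mathbb E) : \mathbb E\in\mathcal C,\ \mathbb E(x)\ge 2^{-H(\mathbb E)(1+\delta)},\ \Sigma(\mathbb E)\le K(x)+\Delta\},$$ which is $\infty$ if the set is empty. A string $x$ is *$k$-well-behaved* ($k\in\mathbb N$) if $K(x)+k\ge C(x)+K(C(x))$. **Theorem.** There is a constant $\omega\in\mathbb N$, depending only on the machines $U$ and $V$, with the following property. Let $f:\mathbb N\to\mathbb N$ be strictly increasing and computable, let $x$ be a $k$-well-behaved string, and let $\mathcal C$ be a decidable and convex set of ensembles that contains the Dirac measure $\delta_x$. If $$\mathcal E_{\delta,\Delta}(x|\mathcal C)>K(C(x))+K(z)+K(f)+K(\mathcal C)+\omega$$ for some $\delta\ge 0$, $z\in\mathbb N$ and $\Delta\ge k+z+K(z)+K(f)+\omega+1+K(\mathcal C)$, then $${\rm Depth}_z(x)>f(C(x)).$$ -/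

import Mathlib

open Encodable

/-- Finite binary strings; `List.length` is the length `ℓ`. -/
abbrev BitString := List Bool

/-! ### Turing machines and the plain computer -/

/-- A deterministic Turing machine with `tapes + 1` two-way infinite tapes, states
`0, …, states` (state `0` is the start state) and tape alphabet consisting of the blank, the two
bits and `extra` further symbols.  In a state, reading one symbol per tape, it either halts
(`none`) or enters a new state and, on every tape, overwrites the scanned symbol and moves its
head one cell or leaves it in place (`none`). -/
structure TuringMachine where
  tapes : ℕ
  states : ℕ
  extra : ℕ
  next : Fin (states + 1) → (Fin (tapes + 1) → Option (Bool ⊕ Fin extra)) →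
    Option (Fin (states + 1) ×
      (Fin (tapes + 1) → Option (Bool ⊕ Fin extra) × Option Turing.Dir))

namespace TuringMachine

/-- Tape symbols; `none` is the blank. -/
abbrev Symbol (M : TuringMachine) := Option (Bool ⊕ Fin M.extra)

/-- A tape with its head: the cells to the left of the head (nearest first), and the cells from the
scanned cell on to the right.  All cells beyond the two lists are blank. -/
abbrev Tape (M : TuringMachine) := List M.Symbol × List M.Symbol

/-- A configuration: the state and the tapes. -/
abbrev Cfg (M : TuringMachine) := Fin (M.states + 1) × (Fin (M.tapes + 1) → M.Tape)

/-- The scanned symbol. -/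
def scan (M : TuringMachine) (t : M.Tape) : M.Symbol := t.2.headD none

/-- Overwrite the scanned symbol, then move the head. -/
def act (M : TuringMachine) (t : M.Tape) (a : M.Symbol × Option Turing.Dir) : M.Tape :=
  match a.2 with
  | none => (t.1, a.1 :: t.2.tail)
  | some Turing.Dir.left => (t.1.tail, t.1.headD none :: a.1 :: t.2.tail)
  | some Turing.Dir.right => (a.1 :: t.1, t.2.tail)

/-- One step of the machine; `none` if the machine halts in this configuration. -/
def step (M : TuringMachine) (c : M.Cfg) : Option M.Cfg :=
  (M.next c.1 fun i => M.scan (c.2 i)).map fun r => (r.1, fun i => M.act (c.2 i) (r.2 i))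

/-- The input is written on the first tape, with the head on its first symbol; the other tapes are
blank. -/
def init (M : TuringMachine) (p : BitString) : M.Cfg :=
  (0, fun i => if i = 0 then ([], p.map fun b => some (Sum.inl b)) else ([], []))

/-- The configuration after `t` steps on input `p`, if the machine has not halted before. -/
def run (M : TuringMachine) (p : BitString) : ℕ → Option M.Cfg
  | 0 => some (M.init p)
  | t + 1 => (M.run p t).bind M.step

/-- The bit of a symbol, if it is one. -/
def bit? (M : TuringMachine) (s : M.Symbol) : Option Bool := s.bind Sum.getLeft?

/-- The output: the block of bits on the last tape that starts at the head and ends before the first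
symbol that is not a bit. -/
def output (M : TuringMachine) (c : M.Cfg) : BitString :=
  ((c.2 (Fin.last M.tapes)).2.takeWhile fun s => (M.bit? s).isSome).filterMap M.bit?

/-- On input `p` the machine halts after exactly `t` steps with output `x`,
that is, `V(p) = x` and `T(p) = t`. -/
def HaltsWith (M : TuringMachine) (p : BitString) (t : ℕ) (x : BitString) : Prop :=
  ∃ c, M.run p t = some c ∧ M.step c = none ∧ M.output c = x

/-- `V` is a universal (plain) computer: it simulates every partial computable function on binary
strings with a constant overhead in the program length. -/
def IsUniversal (V : TuringMachine) : Prop :=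
  ∀ φ : BitString →. BitString, Partrec φ → ∃ c : ℕ, ∀ p x, x ∈ φ p →
    ∃ q : BitString, q.length ≤ p.length + c ∧ ∃ t, V.HaltsWith q t x

/-- Plain Kolmogorov complexity `C(x) = min {ℓ(p) | V(p) = x}`. -/
noncomputable def plainK (V : TuringMachine) (x : BitString) : ℕ :=
  sInf {l | ∃ (p : BitString) (t : ℕ), p.length = l ∧ V.HaltsWith p t x}

/-- Logical depth `min {T(p) | ℓ(p) - C(x) ≤ z, V(p) = x}` at significance level `z`. -/
noncomputable def depth (V : TuringMachine) (z : ℕ) (x : BitString) : ℕ∞ :=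
  sInf {T | ∃ (p : BitString) (t : ℕ), p.length ≤ V.plainK x + z ∧ V.HaltsWith p t x ∧ T = (t : ℕ∞)}

end TuringMachine

/-! ### Ensembles -/

/-- The entropy `H(E) = - ∑ E(x) log₂ E(x)`. -/
noncomputable def entropy (E : PMF BitString) : ℝ :=
  -∑' x, (E x).toReal * Real.logb 2 (E x).toReal

/-- `m / 2ⁿ` approximates the requested quantity with accuracy `2⁻ⁿ`: the request `(some s, n)` asks
for the probability `E(s)`, the request `(none, n)` asks for the entropy `H(E)`. -/
def IsApprox (E : PMF BitString) : Option BitString × ℕ → ℕ → Prop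
  | (some s, n), m => |(m : ℝ) / 2 ^ n - (E s).toReal| ≤ 1 / 2 ^ n
  | (none, n), m => |(m : ℝ) / 2 ^ n - entropy E| ≤ 1 / 2 ^ n

/-- An ensemble: a computable probability distribution on the binary strings whose entropy is finite
and computable. -/
structure Ensemble where
  toPMF : PMF BitString
  finite_entropy : Summable fun x => (toPMF x).toReal * Real.logb 2 (toPMF x).toReal
  computable : ∃ a : Option BitString × ℕ → ℕ, Computable a ∧ ∀ i, IsApprox toPMF i (a i)

theorem pure_mul_logb (x y : BitString) :
    ((PMF.pure x) y).toReal * Real.logb 2 ((PMF.pure x) y).toReal = 0 := by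
  by_cases h : y = x <;> simp [PMF.pure_apply, h]

/-- The Dirac measure `δ_x`. -/
noncomputable def dirac (x : BitString) : Ensemble where
  toPMF := PMF.pure x
  finite_entropy := by
    simp only [pure_mul_logb]
    exact summable_zero
  computable := by
    refine ⟨fun i => if i.1 = some x then 2 ^ i.2 else 0, ?_, ?_⟩
    · have hpow : Primrec fun n : ℕ => 2 ^ n := by
        refine (Primrec.nat_rec₁ (f := fun _ m => 2 * m) 1
          ((Primrec.nat_mul.comp (Primrec.const 2) Primrec.snd).to₂)).of_eq fun n => ?_
        induction n with
        | zero => rfl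
        | succ n ih => rw [pow_succ, mul_comm]; exact congrArg (2 * ·) ih
      exact (Primrec.ite (Primrec.eq.comp Primrec.fst (Primrec.const (some x)))
        (hpow.comp Primrec.snd) (Primrec.const 0)).to_comp
    · rintro ⟨_ | s, n⟩
      · simp only [IsApprox, entropy, pure_mul_logb]
        simp
      · by_cases h : s = x <;> simp [IsApprox, PMF.pure_apply, h]

/-- `x` is `δ`-typical for `E`. -/
def IsTypical (δ : ℝ) (x : BitString) (E : Ensemble) : Prop :=
  (2 : ℝ) ^ (-(entropy E.toPMF * (1 + δ))) ≤ (E.toPMF x).toReal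

/-- A convex set of ensembles: every convex combination of finitely many of its elements that is an
ensemble (in particular computable) belongs to it. -/
def IsConvexConstraint (𝒞 : Set Ensemble) : Prop :=
  ∀ (n : ℕ) (F : Fin n → Ensemble) (w : Fin n → ℝ), (∀ i, F i ∈ 𝒞) →
    (∀ i, 0 < w i ∧ w i < 1) → ∑ i, w i = 1 →
    ∀ E : Ensemble, (∀ s, (E.toPMF s).toReal = ∑ i, w i * ((F i).toPMF s).toReal) → E ∈ 𝒞

/-- A decidable set of ensembles: it is decidable whether `δ_x` belongs to it, given `x`. -/
def IsDecidableConstraint (𝒞 : Set Ensemble) : Prop :=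
  ComputablePred fun x => dirac x ∈ 𝒞

/-! ### The prefix computer -/

/-- A prefix computer: a partial computable function of a program, which is a binary string, and an
input, whose domain is prefix-free in the program for every fixed input.  Inputs and outputs are
finite objects (strings, numbers, pairs, …), coded by natural numbers through the standard computable
coding `Encodable.encode`. -/
structure PrefixComputer where
  eval : BitString → ℕ →. ℕ
  partrec : Partrec₂ eval
  prefix_free : ∀ (y : ℕ) (s t : BitString), (eval s y).Dom → t ≠ [] → ¬ (eval (s ++ t) y).Dom

namespace PrefixComputer

/-- `U` is universal: it simulates every prefix computer, on all inputs at the same time, with a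
constant overhead in the program length. -/
def IsUniversal (U : PrefixComputer) : Prop :=
  ∀ M : PrefixComputer, ∃ c : ℕ, ∀ p : BitString, ∃ q : BitString,
    q.length ≤ p.length + c ∧ ∀ y v, v ∈ M.eval p y → v ∈ U.eval q y

/-- Prefix complexity `K(a) = min {ℓ(p) | U(p) = a}` of a finite object (a string or an integer); the
program is run on the empty input. -/
noncomputable def K (U : PrefixComputer) {α : Type} [Primcodable α] (a : α) : ℕ :=
  sInf {l | ∃ p : BitString, p.length = l ∧ encode a ∈ U.eval p (encode ([] : BitString))}

/-- `K(g)` for a function `g` between finite objects: the length of the shortest program that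
computes `g(a)` from every input `a`. -/
noncomputable def Kfun (U : PrefixComputer) {α β : Type} [Primcodable α] [Primcodable β]
    (g : α → β) : ℕ :=
  sInf {l | ∃ p : BitString, p.length = l ∧ ∀ a, encode (g a) ∈ U.eval p (encode a)}

open Classical in
/-- `K(𝒞)`: the length of the shortest program that computes the function deciding whether
`δ_s ∈ 𝒞`, given `s`. -/
noncomputable def Kconstraint (U : PrefixComputer) (𝒞 : Set Ensemble) : ℕ :=
  U.Kfun fun s : BitString => decide (dirac s ∈ 𝒞)

/-- `K(E)`: the length of the shortest program that approximates the probabilities of `E` and the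
entropy of `E` to any requested accuracy. -/
noncomputable def Kens (U : PrefixComputer) (E : Ensemble) : ℕ :=
  sInf {l | ∃ p : BitString, p.length = l ∧
    ∀ i : Option BitString × ℕ, ∃ m ∈ U.eval p (encode i), IsApprox E.toPMF i m}

/-- The total information `Σ(E) = K(E) + H(E)`. -/
noncomputable def totalInfo (U : PrefixComputer) (E : Ensemble) : ℝ :=
  U.Kens E + entropy E.toPMF

/-- The effective complexity of `x` constrained to `𝒞`; it is `∞` if there is no admissible
ensemble. -/
noncomputable def effComplexity (U : PrefixComputer) (δ Δ : ℝ) (x : BitString)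
    (𝒞 : Set Ensemble) : ℕ∞ :=
  sInf {κ | ∃ E ∈ 𝒞, IsTypical δ x E ∧ U.totalInfo E ≤ U.K x + Δ ∧ κ = (U.Kens E : ℕ∞)}

end PrefixComputer

/-- `x` is `k`-well-behaved: `K(x) + k ≥ C(x) + K(C(x))`. -/
def IsWellBehaved (V : TuringMachine) (U : PrefixComputer) (k : ℕ) (x : BitString) : Prop :=
  V.plainK x + U.K (V.plainK x) ≤ U.K x + k

/-!
The theorem is proved in contrapositive form. Write `n = C(x)` and suppose that the depth of `x` at
significance `z` is at most `f(n)`. Then `x` is among the outputs of `V` within time `f(n)` on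
programs of length at most `n + z`. Let `S` be the set of those outputs `s` for which `δ_s` lies in
`𝒞`, and let `E` be the uniform distribution on `S`. It has three properties.

* `E` is a convex combination of Dirac measures in `𝒞`, so it lies in `𝒞` (`uniformEnsemble_mem`),
  and `x`, as an element of `S`, is typical for it (`uniformEnsemble_isTypical`).
* `S` has at most `2 ^ (n + z + 1)` elements, as there are no more programs, so
  `H(E) ≤ n + z + 1`.
* `E` is determined by `n`, `z`, `f` and the decision function of `𝒞`, so
  `K(E) ≤ K(n) + K(z) + K(f) + K(𝒞) + ω`. Shortest programs for the four objects are simply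
  concatenated. The program for `f` is run on the input `n`, and the one for `𝒞` on the empty string
  as well as on the outputs; since the programs that halt on a fixed input are prefix-free, the
  concatenation splits in only one way, and the machine that looks for the splitting is itself a
  prefix computer (`PrefixComputer.exists_uniformEnsemble_computer`).

As `n + K(n) ≤ K(x) + k`, the total information of `E` is at most `K(x) + Δ`. Hence `E` is admissible
in the effective complexity of `x`, which is therefore at most `K(E)`.

In the formal proof `S` may also contain strings that are on the output tape after `f(n)` steps of a
run that has not halted. This affects none of the three properties and makes the enumeration of outputs a
total, primitive recursive function (`TuringMachine.primrec_outputsWithin`).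
-/

/-! ### Primitive recursive arithmetic and lists -/

theorem Primrec.nat_pow : Primrec₂ ((· ^ ·) : ℕ → ℕ → ℕ) :=
  Primrec₂.unpaired'.1 Nat.Primrec.pow

theorem Primrec.nat_log_two : Primrec (Nat.log 2) := by
  have h : PrimrecRel fun x m : ℕ => 2 ^ m ≤ x :=
    Primrec.nat_le.comp (Primrec.nat_pow.comp (Primrec.const 2) Primrec.snd) Primrec.fst
  refine (Primrec.nat_findGreatest Primrec.id h).of_eq fun x => ?_
  rcases Nat.eq_zero_or_pos x with rfl | hx
  · simp
  · rw [Nat.findGreatest_eq_iff]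
    refine ⟨Nat.log_le_self 2 x, fun _ => Nat.pow_log_le_self 2 hx.ne', fun m hm _ h => ?_⟩
    exact hm.not_ge (Nat.le_log_of_pow_le (by norm_num) h)

theorem PrimrecRel.list_mem {α : Type} [Primcodable α] :
    PrimrecRel fun (a : α) (l : List α) => a ∈ l := by
  classical
  refine PrimrecPred.of_eq (p := fun v : α × List α => v.2.idxOf v.1 < v.2.length) ?_ fun v => ?_
  · exact Primrec.nat_lt.comp (Primrec.list_idxOf.comp Primrec.fst Primrec.snd)
      (Primrec.list_length.comp Primrec.snd)
  · exact List.idxOf_lt_length_iff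

/-- The list of all binary strings of length at most `N`. -/
def stringsUpTo : ℕ → List BitString
  | 0 => [[]]
  | N + 1 => [] :: ((stringsUpTo N).map (List.cons true) ++ (stringsUpTo N).map (List.cons false))

theorem mem_stringsUpTo {N : ℕ} {p : BitString} (h : p.length ≤ N) : p ∈ stringsUpTo N := by
  induction N generalizing p with
  | zero => simp_all [stringsUpTo]
  | succ N ih =>
    match p with
    | [] => simp [stringsUpTo]
    | true :: p => simp [stringsUpTo, ih (p := p) (by simpa using h)]
    | false :: p => simp [stringsUpTo, ih (p := p) (by simpa using h)]

theorem length_stringsUpTo (N : ℕ) : (stringsUpTo N).length + 1 = 2 ^ (N + 1) := by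
  induction N with
  | zero => rfl
  | succ N ih =>
    rw [pow_succ, ← ih]
    simp only [stringsUpTo, List.length_cons, List.length_append, List.length_map]
    ring

theorem primrec_stringsUpTo : Primrec stringsUpTo := by
  have hc (b : Bool) : Primrec fun v : ℕ × List BitString => v.2.map (List.cons b) :=
    Primrec.list_map Primrec.snd
      ((Primrec.list_cons.comp (Primrec.const b) Primrec.snd).to₂)
  refine (Primrec.nat_rec₁ (f := fun _ l => [] :: (l.map (List.cons true) ++
    l.map (List.cons false))) [[]] ((Primrec.list_cons.comp (Primrec.const [])
      (Primrec.list_append.comp (hc true) (hc false))).to₂)).of_eq fun N => ?_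
  induction N with
  | zero => rfl
  | succ N ih => simp only [stringsUpTo, ih]

/-! ### Time-bounded simulation of a Turing machine -/

/-- A direction of head motion is coded by a bit. -/
instance : Primcodable Turing.Dir :=
  Primcodable.ofEquiv Bool
    { toFun := fun d => match d with
        | Turing.Dir.left => true
        | Turing.Dir.right => false
      invFun := fun b => match b with
        | true => Turing.Dir.left
        | false => Turing.Dir.right
      left_inv := by rintro (_ | _) <;> rfl
      right_inv := by rintro (_ | _) <;> rfl }

namespace TuringMachine

/-- One step of the machine, a halted configuration being kept as it is. -/
def stepOrStay (M : TuringMachine) (c : M.Cfg) : M.Cfg := (M.step c).getD c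

/-- What is on the output tape after `m` steps on input `p`, where a machine that has halted earlier
stays in its last configuration.  This is a total function: the machine need not have halted. -/
def outputWithin (M : TuringMachine) (p : BitString) (m : ℕ) : BitString :=
  M.output (M.stepOrStay^[m] (M.init p))

theorem run_eq_some {M : TuringMachine} {p : BitString} {t : ℕ} {c : M.Cfg}
    (h : M.run p t = some c) : M.stepOrStay^[t] (M.init p) = c := by
  induction t generalizing c with
  | zero => simpa [run] using h
  | succ t ih =>
    obtain ⟨d, hd, hc⟩ := Option.bind_eq_some_iff.1 h
    rw [Function.iterate_succ_apply', ih hd, stepOrStay, hc, Option.getD_some]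

theorem HaltsWith.outputWithin_eq {M : TuringMachine} {p : BitString} {t m : ℕ} {x : BitString}
    (h : M.HaltsWith p t x) (htm : t ≤ m) : M.outputWithin p m = x := by
  obtain ⟨c, hc, hs, rfl⟩ := h
  obtain ⟨j, rfl⟩ := Nat.exists_eq_add_of_le' htm
  have hfix : M.stepOrStay c = c := by rw [stepOrStay, hs, Option.getD_none]
  rw [outputWithin, Function.iterate_add_apply, run_eq_some hc, Function.iterate_fixed hfix]

theorem primrec_scan (M : TuringMachine) : Primrec M.scan := by
  refine (Primrec.option_getD.comp (Primrec.list_head?.comp Primrec.snd)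
    (Primrec.const none)).of_eq fun t => ?_
  simp [scan, List.headD_eq_head?_getD]

theorem primrec_act (M : TuringMachine) : Primrec₂ M.act := by
  have hl : Primrec fun v : M.Tape × (M.Symbol × Option Turing.Dir) => v.1.1 :=
    Primrec.fst.comp Primrec.fst
  have hr : Primrec fun v : M.Tape × (M.Symbol × Option Turing.Dir) => v.1.2.tail :=
    Primrec.list_tail.comp (Primrec.snd.comp Primrec.fst)
  have ha : Primrec fun v : M.Tape × (M.Symbol × Option Turing.Dir) => v.2.1 :=
    Primrec.fst.comp Primrec.snd
  have hd : Primrec fun v : M.Tape × (M.Symbol × Option Turing.Dir) => v.2.2 :=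
    Primrec.snd.comp Primrec.snd
  have hh : Primrec fun v : M.Tape × (M.Symbol × Option Turing.Dir) => v.1.1.head?.getD none :=
    Primrec.option_getD.comp (Primrec.list_head?.comp hl) (Primrec.const none)
  have hleft := (Primrec.list_tail.comp hl).pair
    (Primrec.list_cons.comp hh (Primrec.list_cons.comp ha hr))
  have hright := (Primrec.list_cons.comp ha hl).pair hr
  have hstay := hl.pair (Primrec.list_cons.comp ha hr)
  refine (Primrec.ite (Primrec.eq.comp hd (Primrec.const none)) hstay
    (Primrec.ite (Primrec.eq.comp hd (Primrec.const (some Turing.Dir.left))) hleft hright)).of_eq ?_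
  rintro ⟨t, a, _ | _ | _⟩ <;> simp [act, List.headD_eq_head?_getD]

theorem primrec_stepOrStay (M : TuringMachine) : Primrec M.stepOrStay := by
  have htapes : Primrec₂ fun (v : M.Cfg) (i : Fin (M.tapes + 1)) => v.2 i :=
    Primrec.fin_app.comp (Primrec.snd.comp Primrec.fst) Primrec.snd
  have hscan : Primrec fun c : M.Cfg => fun i => M.scan (c.2 i) :=
    Primrec.fin_curry.2 (M.primrec_scan.comp htapes)
  -- The transition table is finite.
  have hnext : Primrec fun c : M.Cfg => M.next c.1 fun i => M.scan (c.2 i) :=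
    (Primrec.dom_finite fun v : Fin (M.states + 1) × (Fin (M.tapes + 1) → M.Symbol) =>
      M.next v.1 v.2).comp (Primrec.fst.pair hscan)
  have hact : Primrec fun w : M.Cfg × (Fin (M.states + 1) ×
      (Fin (M.tapes + 1) → M.Symbol × Option Turing.Dir)) =>
      fun i => M.act (w.1.2 i) (w.2.2 i) :=
    Primrec.fin_curry.2 (M.primrec_act.comp
      (Primrec.fin_app.comp (Primrec.snd.comp (Primrec.fst.comp Primrec.fst)) Primrec.snd)
      (Primrec.fin_app.comp (Primrec.snd.comp (Primrec.snd.comp Primrec.fst)) Primrec.snd))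
  exact Primrec.option_getD.comp
    (Primrec.option_map hnext (((Primrec.fst.comp Primrec.snd).pair hact).to₂)) Primrec.id

theorem primrec_init (M : TuringMachine) : Primrec M.init := by
  refine (Primrec.const 0).pair (Primrec.fin_curry.2 ?_)
  refine Primrec.ite (Primrec.eq.comp Primrec.snd (Primrec.const 0))
    ((Primrec.const []).pair (Primrec.list_map Primrec.fst
      ((Primrec.option_some.comp (Primrec.sumInl.comp Primrec.snd)).to₂))) (Primrec.const ([], []))

theorem primrec_output (M : TuringMachine) : Primrec M.output := by
  have hbit : Primrec M.bit? := Primrec.dom_finite _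
  have htape : Primrec fun c : M.Cfg => (c.2 (Fin.last M.tapes)).2 :=
    Primrec.snd.comp (Primrec.fin_app.comp Primrec.snd (Primrec.const (Fin.last M.tapes)))
  exact Primrec.listFilterMap ((Primrec.list_takeWhile
    (Primrec.option_isSome.comp hbit)).comp htape) ((hbit.comp Primrec.snd).to₂)

theorem primrec_outputWithin (M : TuringMachine) : Primrec₂ M.outputWithin :=
  M.primrec_output.comp (Primrec.nat_iterate Primrec.snd (M.primrec_init.comp Primrec.fst)
    ((M.primrec_stepOrStay.comp Primrec.snd).to₂))

/-- The outputs after `m` steps of the programs of length at most `N`. -/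
def outputsWithin (M : TuringMachine) (N m : ℕ) : List BitString :=
  (stringsUpTo N).map fun p => M.outputWithin p m

theorem primrec_outputsWithin (M : TuringMachine) : Primrec₂ M.outputsWithin :=
  Primrec.list_map (primrec_stringsUpTo.comp Primrec.fst)
    ((M.primrec_outputWithin.comp Primrec.snd (Primrec.snd.comp Primrec.fst)).to₂)

end TuringMachine

/-! ### Uniform ensembles -/

/-- A natural number `m` such that `m / 2ʲ` approximates, to accuracy `2⁻ʲ`, the requested
probability or the entropy of the uniform distribution on the entries of `L`.  For the entropy,
`⌊2ʲ log₂ N⌋` is computed as the integer logarithm of `N ^ 2ʲ`. -/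
def uniformApprox (L : List BitString) : Option BitString × ℕ → ℕ
  | (some s, j) => if s ∈ L then 2 ^ j / L.length else 0
  | (none, j) => Nat.log 2 (L.length ^ 2 ^ j)

theorem primrec_uniformApprox : Primrec₂ uniformApprox := by
  have hlen : Primrec fun v : List BitString × (Option BitString × ℕ) => v.1.length :=
    Primrec.list_length.comp Primrec.fst
  have hpow : Primrec fun v : List BitString × (Option BitString × ℕ) => 2 ^ v.2.2 :=
    Primrec.nat_pow.comp (Primrec.const 2) (Primrec.snd.comp Primrec.snd)
  have hlog := Primrec.nat_log_two.comp (Primrec.nat_pow.comp hlen hpow)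
  have hprob : Primrec₂ fun (v : List BitString × (Option BitString × ℕ)) (s : BitString) =>
      if s ∈ v.1 then 2 ^ v.2.2 / v.1.length else 0 :=
    Primrec.ite (PrimrecRel.list_mem.comp Primrec.snd (Primrec.fst.comp Primrec.fst))
      (Primrec.nat_div.comp (hpow.comp Primrec.fst) (hlen.comp Primrec.fst)) (Primrec.const 0)
  refine (Primrec.option_casesOn (Primrec.fst.comp Primrec.snd) hlog hprob).of_eq ?_
  rintro ⟨L, _ | s, j⟩ <;> rfl

theorem uniform_toReal (S : Finset BitString) (hS : S.Nonempty) (s : BitString) :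
    ((PMF.uniformOfFinset S hS) s).toReal = if s ∈ S then 1 / (S.card : ℝ) else 0 := by
  rw [PMF.uniformOfFinset_apply]
  split_ifs <;> simp

theorem entropy_uniform (S : Finset BitString) (hS : S.Nonempty) :
    entropy (PMF.uniformOfFinset S hS) = Real.logb 2 S.card := by
  have hc : (S.card : ℝ) ≠ 0 := by exact_mod_cast hS.card_pos.ne'
  unfold entropy
  rw [tsum_eq_sum (s := S) fun s hs => by rw [uniform_toReal, if_neg hs, zero_mul],
    Finset.sum_congr rfl fun s hs => by rw [uniform_toReal, if_pos hs], Finset.sum_const,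
    nsmul_eq_mul, one_div, Real.logb_inv]
  field_simp

theorem isApprox_uniform {L : List BitString} {S : Finset BitString} (hL : L.Nodup)
    (hLS : L.toFinset = S) (hS : S.Nonempty) (i : Option BitString × ℕ) :
    IsApprox (PMF.uniformOfFinset S hS) i (uniformApprox L i) := by
  subst hLS
  have hcard : L.toFinset.card = L.length := List.toFinset_card_of_nodup hL
  have hpos : 0 < L.length := hcard ▸ hS.card_pos
  have hposR : (0 : ℝ) < L.length := by exact_mod_cast hpos
  obtain ⟨_ | s, j⟩ := i
  all_goals
    have h2 : (0 : ℝ) < 2 ^ j := by positivity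
  · simp only [IsApprox, uniformApprox, entropy_uniform, hcard]
    have hne : L.length ^ 2 ^ j ≠ 0 := (pow_pos hpos _).ne'
    have hlog : Real.logb 2 ((L.length ^ 2 ^ j : ℕ) : ℝ) = 2 ^ j * Real.logb 2 L.length := by
      push_cast
      rw [Real.logb_pow]
      push_cast
      rfl
    have hlo : ((Nat.log 2 (L.length ^ 2 ^ j) : ℕ) : ℝ) ≤ 2 ^ j * Real.logb 2 L.length := by
      rw [← hlog]; exact Real.natLog_le_logb _ _
    have hhi : 2 ^ j * Real.logb 2 L.length < (Nat.log 2 (L.length ^ 2 ^ j) : ℕ) + 1 := by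
      rw [← hlog, Real.logb_lt_iff_lt_rpow (by norm_num) (by positivity)]
      exact_mod_cast Nat.lt_pow_succ_log_self (by norm_num) _
    rw [div_sub' h2.ne', abs_div, abs_of_pos h2]
    gcongr
    rw [abs_le]
    constructor <;> linarith
  · simp only [IsApprox, uniformApprox, uniform_toReal, hcard, List.mem_toFinset]
    split_ifs with hs
    · have hlo : ((2 ^ j / L.length : ℕ) : ℝ) ≤ 2 ^ j / L.length := by
        exact_mod_cast Nat.cast_div_le (α := ℝ) (m := 2 ^ j) (n := L.length)
      have hhi : (2 : ℝ) ^ j / L.length < (2 ^ j / L.length : ℕ) + 1 := by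
        rw [div_lt_iff₀ hposR]
        exact_mod_cast Nat.lt_mul_of_div_lt (Nat.lt_succ_self _) hpos
      rw [div_sub' h2.ne', abs_div, abs_of_pos h2]
      gcongr
      rw [abs_le, mul_one_div]
      constructor <;> linarith
    · simp

/-- The uniform distribution on a nonempty finite set of strings. -/
noncomputable def uniformEnsemble (S : Finset BitString) (hS : S.Nonempty) : Ensemble where
  toPMF := PMF.uniformOfFinset S hS
  finite_entropy := summable_of_ne_finset_zero (s := S) fun s hs => by
    rw [uniform_toReal, if_neg hs, zero_mul]
  computable := ⟨uniformApprox S.toList,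
    (primrec_uniformApprox.comp (Primrec.const S.toList) Primrec.id).to_comp,
    isApprox_uniform S.nodup_toList S.toList_toFinset hS⟩

theorem dirac_toReal (x s : BitString) :
    ((dirac x).toPMF s).toReal = if s = x then 1 else 0 := by
  simp only [dirac, PMF.pure_apply]
  split_ifs <;> simp

theorem uniformEnsemble_mem {𝒞 : Set Ensemble} (hconv : IsConvexConstraint 𝒞)
    (S : Finset BitString) (hS : S.Nonempty) (hmem : ∀ s ∈ S, dirac s ∈ 𝒞) :
    uniformEnsemble S hS ∈ 𝒞 := by
  rcases (Nat.succ_le_of_lt hS.card_pos).eq_or_lt with h | h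
  -- Convexity only speaks of weights below one, so a singleton is treated separately.
  · obtain ⟨s, rfl⟩ := Finset.card_eq_one.1 h.symm
    suffices he : uniformEnsemble {s} hS = dirac s from he ▸ hmem s (by simp)
    rw [uniformEnsemble, dirac, Ensemble.mk.injEq]
    ext y
    simp [PMF.uniformOfFinset_apply, PMF.pure_apply]
  · have h1 : (1 : ℝ) < S.card := by exact_mod_cast h
    refine hconv S.card (fun i => dirac (S.equivFin.symm i)) (fun _ => 1 / (S.card : ℝ))
      (fun i => hmem _ (S.equivFin.symm i).2) (fun _ => ⟨by positivity, ?_⟩) ?_ _ fun s => ?_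
    · rwa [div_lt_one (by positivity)]
    · have : (S.card : ℝ) ≠ 0 := by positivity
      simp [this]
    · rw [Equiv.sum_comp S.equivFin.symm fun y : S =>
        1 / (S.card : ℝ) * ((dirac (y : BitString)).toPMF s).toReal,
        Finset.sum_coe_sort S fun y => 1 / (S.card : ℝ) * ((dirac y).toPMF s).toReal]
      simp only [uniformEnsemble, uniform_toReal]
      simp [dirac_toReal]

theorem uniformEnsemble_isTypical {δ : ℝ} (hδ : 0 ≤ δ) (S : Finset BitString) (hS : S.Nonempty)
    {x : BitString} (hx : x ∈ S) : IsTypical δ x (uniformEnsemble S hS) := by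
  have hpos : (1 : ℝ) ≤ S.card := by exact_mod_cast hS.card_pos
  have hlog : 0 ≤ Real.logb 2 S.card := Real.logb_nonneg (by norm_num) hpos
  simp only [IsTypical, uniformEnsemble, entropy_uniform, uniform_toReal, hx, if_true]
  calc (2 : ℝ) ^ (-(Real.logb 2 S.card * (1 + δ)))
      ≤ 2 ^ (-Real.logb 2 S.card) :=
        Real.rpow_le_rpow_of_exponent_le (by norm_num) (by nlinarith)
    _ = 1 / (S.card : ℝ) := by
        rw [Real.rpow_neg (by norm_num), Real.rpow_logb (by norm_num) (by norm_num) (by linarith),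
          one_div]

/-! ### Prefix computers -/

namespace PrefixComputer

theorem append_inj (U : PrefixComputer) {y : ℕ} {a a' u u' : BitString}
    (ha : (U.eval a y).Dom) (ha' : (U.eval a' y).Dom) (h : a ++ u = a' ++ u') :
    a = a' ∧ u = u' := by
  have hext {s t w : BitString} (hs : (U.eval s y).Dom) (ht : (U.eval t y).Dom)
      (hw : t = s ++ w) : w = [] := by
    by_contra hne
    exact U.prefix_free y s w hs hne (hw ▸ ht)
  rcases List.append_eq_append_iff.1 h with ⟨w, rfl, rfl⟩ | ⟨w, rfl, rfl⟩
  · obtain rfl := hext ha ha' rfl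
    simp
  · obtain rfl := hext ha' ha rfl
    simp

theorem IsUniversal.exists_program {U : PrefixComputer} (hU : U.IsUniversal) {α β : Type}
    [Primcodable α] [Primcodable β] {g : α → β} (hg : Computable g) :
    ∃ p : BitString, ∀ a, encode (g a) ∈ U.eval p (encode a) := by
  -- The machine that computes `g` with the empty program.
  let h : BitString → ℕ → Option ℕ := fun p y =>
    if p = [] then (decode (α := α) y).map fun a => encode (g a) else none
  have hh : Computable₂ h := by
    have hc : Computable fun v : BitString × ℕ => decide (v.1 = []) := by
      obtain ⟨_, hd⟩ := (Primrec.eq.comp (Primrec.fst (α := BitString) (β := ℕ))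
        (Primrec.const []))
      exact hd.to_comp.of_eq fun _ => by congr
    have hm : Computable fun v : BitString × ℕ =>
        (decode (α := α) v.2).map fun a => encode (g a) :=
      Computable.option_map (Computable.decode.comp Computable.snd)
        ((Computable.encode.comp (hg.comp Computable.snd)).to₂)
    refine (Computable.cond hc hm (Computable.const none)).of_eq fun v => ?_
    simp only [h, Bool.cond_decide]
  let M : PrefixComputer :=
    { eval := fun p y => (h p y : Part ℕ)
      partrec := hh.ofOption
      prefix_free := by
        intro y s t hs ht hst
        obtain ⟨v, hv⟩ := Part.dom_iff_mem.1 hst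
        simp [h, ht] at hv }
  obtain ⟨c, hc⟩ := hU M
  obtain ⟨q, -, hq⟩ := hc []
  exact ⟨q, fun a => hq _ _ (by simp [M, h])⟩

theorem IsUniversal.exists_length_eq_Kfun {U : PrefixComputer} (hU : U.IsUniversal) {α β : Type}
    [Primcodable α] [Primcodable β] {g : α → β} (hg : Computable g) :
    ∃ p : BitString, p.length = U.Kfun g ∧ ∀ a, encode (g a) ∈ U.eval p (encode a) := by
  obtain ⟨p, hp⟩ := hU.exists_program hg
  exact Nat.sInf_mem (s := {l | ∃ p : BitString, p.length = l ∧
    ∀ a, encode (g a) ∈ U.eval p (encode a)}) ⟨_, p, rfl, hp⟩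

theorem IsUniversal.exists_length_eq_K {U : PrefixComputer} (hU : U.IsUniversal) {α : Type}
    [Primcodable α] (a : α) :
    ∃ p : BitString, p.length = U.K a ∧ encode a ∈ U.eval p (encode ([] : BitString)) := by
  obtain ⟨p, hp⟩ := hU.exists_program (Computable.const (α := BitString) a)
  exact Nat.sInf_mem (s := {l | ∃ p : BitString, p.length = l ∧
    encode a ∈ U.eval p (encode ([] : BitString))}) ⟨_, p, rfl, hp []⟩

/-- A computable enumeration of the graph of `U`: `G k p y` is the value of `U` on the program `p`
and the input `y` if it is found within resources `k`, and `none` otherwise. -/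
theorem exists_bounded_eval (U : PrefixComputer) :
    ∃ G : ℕ → BitString → ℕ → Option ℕ,
      (Primrec fun w : ℕ × BitString × ℕ => G w.1 w.2.1 w.2.2) ∧
      (∀ k p y v, G k p y = some v → v ∈ U.eval p y) ∧
      (∀ k k' p y v, k ≤ k' → G k p y = some v → G k' p y = some v) ∧
      ∀ p y v, v ∈ U.eval p y → ∃ k, G k p y = some v := by
  obtain ⟨c, hc⟩ := Nat.Partrec.Code.exists_code.1 U.partrec
  have heval (p : BitString) (y v : ℕ) : v ∈ c.eval (encode (p, y)) ↔ v ∈ U.eval p y := by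
    rw [hc]
    simp
  refine ⟨fun k p y => Nat.Partrec.Code.evaln k c (encode (p, y)), ?_, ?_, ?_, ?_⟩
  · exact Nat.Partrec.Code.primrec_evaln.comp ((Primrec.fst.pair (Primrec.const c)).pair
      (Primrec.encode.comp Primrec.snd))
  · exact fun k p y v h => (heval p y v).1 (Nat.Partrec.Code.evaln_sound h)
  · exact fun k k' p y v hk h => Nat.Partrec.Code.evaln_mono hk h
  · exact fun p y v h => Nat.Partrec.Code.evaln_complete.1 ((heval p y v).2 h)

/-- The entries of `l`, without repetitions, whose code has value `encode true` under `g`; it is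
`none` if `g` has no value on one of the entries. -/
def select (g : ℕ → Option ℕ) (l : List BitString) : Option (List BitString) :=
  l.foldr (fun s acc => acc.bind fun r => (g (encode s)).map fun v =>
    if v = encode true ∧ s ∉ r then s :: r else r) (some [])

theorem select_spec {g : ℕ → Option ℕ} {P : BitString → Prop} [DecidablePred P]
    (hg : ∀ s v, g (encode s) = some v → v = encode (decide (P s))) {l r : List BitString}
    (h : select g l = some r) : r.Nodup ∧ ∀ s, s ∈ r ↔ s ∈ l ∧ P s := by
  induction l generalizing r with
  | nil =>
    obtain rfl : [] = r := by simpa [select] using h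
    simp
  | cons a l ih =>
    rw [select, List.foldr_cons, Option.bind_eq_some_iff] at h
    obtain ⟨r₀, h₀, h⟩ := h
    obtain ⟨v, hv, rfl⟩ := Option.map_eq_some_iff.1 h
    obtain ⟨hnd, hmem⟩ := ih h₀
    have hv' : v = encode true ↔ P a := by
      rw [hg a v hv, encode_inj, decide_eq_true_iff]
    simp only [hv']
    split_ifs with hc
    · refine ⟨List.nodup_cons.2 ⟨hc.2, hnd⟩, fun s => ?_⟩
      grind
    · exact ⟨hnd, fun s => by grind⟩

theorem exists_select_eq_some {g : ℕ → Option ℕ} {l : List BitString}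
    (h : ∀ s ∈ l, ∃ v, g (encode s) = some v) : ∃ r, select g l = some r := by
  induction l with
  | nil => exact ⟨[], rfl⟩
  | cons a l ih =>
    obtain ⟨r, hr⟩ := ih fun s hs => h s (List.mem_cons_of_mem _ hs)
    obtain ⟨v, hv⟩ := h a List.mem_cons_self
    rw [select] at hr
    rw [select, List.foldr_cons, hr, hv]
    exact ⟨_, rfl⟩

theorem primrec_select {α : Type} [Primcodable α] {g : α → ℕ → Option ℕ} {l : α → List BitString}
    (hg : Primrec₂ g) (hl : Primrec l) : Primrec fun a => select (g a) (l a) := by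
  have hadd : Primrec fun w : (BitString × List BitString) × ℕ =>
      if w.2 = encode true ∧ w.1.1 ∉ w.1.2 then w.1.1 :: w.1.2 else w.1.2 :=
    Primrec.ite (PrimrecPred.and (Primrec.eq.comp Primrec.snd (Primrec.const (encode true)))
      (PrimrecPred.not (PrimrecRel.list_mem.comp (Primrec.fst.comp Primrec.fst)
        (Primrec.snd.comp Primrec.fst)))) (Primrec.list_cons.comp (Primrec.fst.comp Primrec.fst)
        (Primrec.snd.comp Primrec.fst)) (Primrec.snd.comp Primrec.fst)
  have hbind : Primrec₂ fun (w : α × BitString × Option (List BitString)) (r : List BitString) =>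
      (g w.1 (encode w.2.1)).map fun v => if v = encode true ∧ w.2.1 ∉ r then w.2.1 :: r else r := by
    refine Primrec.option_map (hg.comp (Primrec.fst.comp Primrec.fst) (Primrec.encode.comp
      (Primrec.fst.comp (Primrec.snd.comp Primrec.fst)))) ?_
    exact (hadd.comp (((Primrec.fst.comp (Primrec.snd.comp (Primrec.fst.comp Primrec.fst))).pair
      (Primrec.snd.comp Primrec.fst)).pair Primrec.snd)).to₂
  exact Primrec.list_foldr hl (Primrec.const (some []))
    (Primrec.option_bind (Primrec.snd.comp Primrec.snd) hbind).to₂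

end PrefixComputer

/-! ### Describing a uniform ensemble by self-delimiting parts -/

namespace PrefixComputer

/-- A list of strings described by `p = a ++ b ++ c ++ d`, as far as it is found within resources
`k` by the bounded evaluation `G` of a prefix computer: `a` computes a number `n`, `b` computes a
number `z`, `c` computes a number `m` from `n`, and of the outputs of `V` after `m` steps on
programs of length at most `n + z` those are listed which `d` accepts.  The value of `d` at the
empty string is required in any case, so that the end of `p` is determined. -/
def describedList (V : TuringMachine) (G : ℕ → BitString → ℕ → Option ℕ) (p : BitString) (k : ℕ)
    (a b c d : BitString) : Option (List BitString) :=
  if a ++ (b ++ (c ++ d)) = p then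
    (G k a (encode ([] : BitString))).bind fun n =>
      (G k b (encode ([] : BitString))).bind fun z =>
        (G k c n).bind fun m => (G k d (encode ([] : BitString))).bind fun _ =>
          select (G k d) (V.outputsWithin (n + z) m)
  else none

theorem describedList_eq_some {V : TuringMachine} {G : ℕ → BitString → ℕ → Option ℕ} {k : ℕ}
    {p a b c d : BitString} {L : List BitString} :
    describedList V G p k a b c d = some L ↔ a ++ (b ++ (c ++ d)) = p ∧
      ∃ n, G k a (encode ([] : BitString)) = some n ∧
      ∃ z, G k b (encode ([] : BitString)) = some z ∧ ∃ m, G k c n = some m ∧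
      ∃ v, G k d (encode ([] : BitString)) = some v ∧
        select (G k d) (V.outputsWithin (n + z) m) = some L := by
  unfold describedList
  split_ifs with h <;> simp [h, Option.bind_eq_some_iff]

theorem primrec_describedList (V : TuringMachine) {G : ℕ → BitString → ℕ → Option ℕ}
    (hG : Primrec fun w : ℕ × BitString × ℕ => G w.1 w.2.1 w.2.2) :
    Primrec fun w : BitString × ℕ × BitString × BitString × BitString × BitString =>
      describedList V G w.1 w.2.1 w.2.2.1 w.2.2.2.1 w.2.2.2.2.1 w.2.2.2.2.2 := by
  have hG' {α : Type} [Primcodable α] {k : α → ℕ} {p : α → BitString} {y : α → ℕ} (hk : Primrec k)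
      (hp : Primrec p) (hy : Primrec y) : Primrec fun a => G (k a) (p a) (y a) :=
    hG.comp (hk.pair (hp.pair hy))
  let X := BitString × ℕ × BitString × BitString × BitString × BitString
  have hp : Primrec fun w : X => w.1 := Primrec.fst
  have hk : Primrec fun w : X => w.2.1 := Primrec.fst.comp Primrec.snd
  have ht : Primrec fun w : X => w.2.2 := Primrec.snd.comp Primrec.snd
  have ha : Primrec fun w : X => w.2.2.1 := Primrec.fst.comp ht
  have hb : Primrec fun w : X => w.2.2.2.1 := Primrec.fst.comp (Primrec.snd.comp ht)
  have hc : Primrec fun w : X => w.2.2.2.2.1 :=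
    Primrec.fst.comp (Primrec.snd.comp (Primrec.snd.comp ht))
  have hd : Primrec fun w : X => w.2.2.2.2.2 :=
    Primrec.snd.comp (Primrec.snd.comp (Primrec.snd.comp ht))
  have he {α : Type} [Primcodable α] : Primrec fun _ : α => encode ([] : BitString) :=
    Primrec.const _
  have h4 : Primrec₂ fun (w : ((X × ℕ) × ℕ) × ℕ) (_ : ℕ) =>
      select (G w.1.1.1.2.1 w.1.1.1.2.2.2.2.2) (V.outputsWithin (w.1.1.2 + w.1.2) w.2) := by
    have hX : Primrec fun w : (((X × ℕ) × ℕ) × ℕ) × ℕ => w.1.1.1.1 :=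
      Primrec.fst.comp (Primrec.fst.comp (Primrec.fst.comp Primrec.fst))
    refine primrec_select (hG' (hk.comp (hX.comp Primrec.fst)) (hd.comp (hX.comp Primrec.fst))
      Primrec.snd) (V.primrec_outputsWithin.comp (Primrec.nat_add.comp ?_ ?_) ?_)
    · exact Primrec.snd.comp (Primrec.fst.comp (Primrec.fst.comp Primrec.fst))
    · exact Primrec.snd.comp (Primrec.fst.comp Primrec.fst)
    · exact Primrec.snd.comp Primrec.fst
  have h3 : Primrec₂ fun (w : (X × ℕ) × ℕ) (m : ℕ) =>
      (G w.1.1.2.1 w.1.1.2.2.2.2.2 (encode ([] : BitString))).bind fun _ =>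
        select (G w.1.1.2.1 w.1.1.2.2.2.2.2) (V.outputsWithin (w.1.2 + w.2) m) := by
    have hX : Primrec fun w : ((X × ℕ) × ℕ) × ℕ => w.1.1.1 :=
      Primrec.fst.comp (Primrec.fst.comp Primrec.fst)
    exact Primrec.option_bind (hG' (hk.comp hX) (hd.comp hX) he) h4
  have h2 : Primrec₂ fun (w : X × ℕ) (z : ℕ) => (G w.1.2.1 w.1.2.2.2.2.1 w.2).bind fun m =>
      (G w.1.2.1 w.1.2.2.2.2.2 (encode ([] : BitString))).bind fun _ =>
        select (G w.1.2.1 w.1.2.2.2.2.2) (V.outputsWithin (w.2 + z) m) := by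
    have hX : Primrec fun w : (X × ℕ) × ℕ => w.1.1 := Primrec.fst.comp Primrec.fst
    exact Primrec.option_bind
      (hG' (hk.comp hX) (hc.comp hX) (Primrec.snd.comp Primrec.fst)) h3
  have h1 : Primrec₂ fun (w : X) (n : ℕ) =>
      (G w.2.1 w.2.2.2.1 (encode ([] : BitString))).bind fun z =>
        (G w.2.1 w.2.2.2.2.1 n).bind fun m =>
          (G w.2.1 w.2.2.2.2.2 (encode ([] : BitString))).bind fun _ =>
            select (G w.2.1 w.2.2.2.2.2) (V.outputsWithin (n + z) m) :=
    Primrec.option_bind (hG' (hk.comp Primrec.fst) (hb.comp Primrec.fst) he) h2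
  exact Primrec.ite (Primrec.eq.comp (Primrec.list_append.comp ha (Primrec.list_append.comp hb
    (Primrec.list_append.comp hc hd))) hp) (Primrec.option_bind (hG' hk ha he) h1)
    (Primrec.const none)

/-- There is a single prefix computer that approximates the uniform ensemble on the outputs of `V`
after `m` steps on programs of length at most `n + z` that satisfy a decidable property `P`, from
the concatenation of self-delimiting programs for `n`, for `z`, for `m` given `n`, and for `P`. -/
theorem exists_uniformEnsemble_computer (V : TuringMachine) (U : PrefixComputer) :
    ∃ M : PrefixComputer, ∀ (a b c d : BitString) (n z m : ℕ) (P : BitString → Prop)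
      [DecidablePred P], n ∈ U.eval a (encode ([] : BitString)) →
      z ∈ U.eval b (encode ([] : BitString)) → m ∈ U.eval c n →
      (∀ s, encode (decide (P s)) ∈ U.eval d (encode s)) →
      ∀ hS : ((V.outputsWithin (n + z) m).toFinset.filter P).Nonempty,
      ∀ i : Option BitString × ℕ, ∃ v ∈ M.eval (a ++ (b ++ (c ++ d))) (encode i),
        IsApprox (uniformEnsemble _ hS).toPMF i v := by
  obtain ⟨G, hG, hsound, hmono, hcomplete⟩ := U.exists_bounded_eval
  -- Search for a decomposition of `p` and for resources that suffice to evaluate its parts.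
  let h : BitString → ℕ → ℕ → Option ℕ := fun p y N =>
    (decode (α := ℕ × BitString × BitString × BitString × BitString) N).bind fun w =>
      (describedList V G p w.1 w.2.1 w.2.2.1 w.2.2.2.1 w.2.2.2.2).bind fun L =>
        (decode (α := Option BitString × ℕ) y).map (uniformApprox L)
  have hh : Primrec fun v : (BitString × ℕ) × ℕ => h v.1.1 v.1.2 v.2 := by
    let W := ℕ × BitString × BitString × BitString × BitString
    have h2 : Primrec₂ fun (v : ((BitString × ℕ) × ℕ) × W) (L : List BitString) =>
        (decode (α := Option BitString × ℕ) v.1.1.2).map (uniformApprox L) :=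
      Primrec.option_map (Primrec.decode.comp (Primrec.snd.comp
        (Primrec.fst.comp (Primrec.fst.comp Primrec.fst))))
        ((primrec_uniformApprox.comp (Primrec.snd.comp Primrec.fst) Primrec.snd).to₂)
    have h1 : Primrec₂ fun (v : (BitString × ℕ) × ℕ) (w : W) =>
        (describedList V G v.1.1 w.1 w.2.1 w.2.2.1 w.2.2.2.1 w.2.2.2.2).bind fun L =>
          (decode (α := Option BitString × ℕ) v.1.2).map (uniformApprox L) :=
      Primrec.option_bind ((primrec_describedList V hG).comp
        ((Primrec.fst.comp (Primrec.fst.comp Primrec.fst)).pair Primrec.snd)) h2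
    exact Primrec.option_bind (Primrec.decode.comp Primrec.snd) h1
  have hspec {p : BitString} {y N v : ℕ} (hv : h p y N = some v) : ∃ k a b c d L i,
      describedList V G p k a b c d = some L ∧ decode y = some i ∧ uniformApprox L i = v := by
    obtain ⟨w, -, hw⟩ := Option.bind_eq_some_iff.1 hv
    obtain ⟨L, hL, hw⟩ := Option.bind_eq_some_iff.1 hw
    obtain ⟨i, hi, rfl⟩ := Option.map_eq_some_iff.1 hw
    exact ⟨_, _, _, _, _, L, i, hL, hi, rfl⟩
  have hdom {k : ℕ} {p : BitString} {y v : ℕ} (hv : G k p y = some v) : (U.eval p y).Dom :=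
    Part.dom_iff_mem.2 ⟨v, hsound k p y v hv⟩
  -- Two decompositions that share a prefix agree, as the parts are self-delimiting one by one.
  have hunique {k k' : ℕ} {p t a b c d a' b' c' d' : BitString} {L L' : List BitString}
      (h : describedList V G p k a b c d = some L)
      (h' : describedList V G (p ++ t) k' a' b' c' d' = some L') :
      t = [] ∧ a = a' ∧ b = b' ∧ c = c' ∧ d = d' := by
    obtain ⟨rfl, n, hn, z, hz, m, hm, v, hv, -⟩ := describedList_eq_some.1 h
    obtain ⟨hp, n', hn', z', hz', m', hm', v', hv', -⟩ := describedList_eq_some.1 h'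
    simp only [List.append_assoc] at hp
    obtain ⟨rfl, hbcd⟩ := U.append_inj (hdom hn') (hdom hn) hp
    obtain rfl : n' = n := Part.mem_unique (hsound _ _ _ _ hn') (hsound _ _ _ _ hn)
    obtain ⟨rfl, hcd⟩ := U.append_inj (hdom hz') (hdom hz) hbcd
    obtain ⟨rfl, hd⟩ := U.append_inj (hdom hm') (hdom hm) hcd
    obtain ⟨rfl, ht⟩ := U.append_inj (u := []) (hdom hv') (hdom hv) (by simpa using hd)
    exact ⟨ht.symm, rfl, rfl, rfl, rfl⟩
  let M : PrefixComputer :=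
    { eval := fun p y => Nat.rfindOpt (h p y)
      partrec := Partrec.rfindOpt (f := fun (v : BitString × ℕ) N => h v.1 v.2 N) hh.to_comp
      prefix_free := by
        intro y s t hs ht hst
        obtain ⟨N, v, hv⟩ := Nat.rfindOpt_dom.1 hs
        obtain ⟨N', v', hv'⟩ := Nat.rfindOpt_dom.1 hst
        obtain ⟨k, a, b, c, d, L, -, hL, -⟩ := hspec hv
        obtain ⟨k', a', b', c', d', L', -, hL', -⟩ := hspec hv'
        exact ht (hunique hL hL').1 }
  refine ⟨M, fun a b c d n z m P _ ha hb hc hd hS i => ?_⟩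
  obtain ⟨k, L, hlist⟩ : ∃ k L, describedList V G (a ++ (b ++ (c ++ d))) k a b c d = some L := by
    obtain ⟨k₁, h₁⟩ := hcomplete _ _ _ ha
    obtain ⟨k₂, h₂⟩ := hcomplete _ _ _ hb
    obtain ⟨k₃, h₃⟩ := hcomplete _ _ _ hc
    choose κ hκ using fun s => hcomplete _ _ _ (hd s)
    -- Resources that suffice for all evaluations, those of `d` on the finitely many outputs included.
    let S := insert [] (V.outputsWithin (n + z) m).toFinset
    let k := k₁ + k₂ + k₃ + S.sup κ
    have hk {s : BitString} (hs : s ∈ S) : G k d (encode s) = some (encode (decide (P s))) :=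
      hmono _ _ _ _ _ ((Finset.le_sup hs).trans (by omega)) (hκ s)
    obtain ⟨L, hL⟩ := exists_select_eq_some (g := G k d) (l := V.outputsWithin (n + z) m)
      fun s hs => ⟨_, hk (Finset.mem_insert_of_mem (List.mem_toFinset.2 hs))⟩
    exact ⟨k, L, describedList_eq_some.2 ⟨rfl, n, hmono _ _ _ _ _ (by omega) h₁, z,
      hmono _ _ _ _ _ (by omega) h₂, m, hmono _ _ _ _ _ (by omega) h₃, _,
      hk (Finset.mem_insert_self _ _), hL⟩⟩
  obtain ⟨v, hv⟩ := Part.dom_iff_mem.1 (Nat.rfindOpt_dom.2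
    ⟨encode (k, a, b, c, d), uniformApprox L i, by
      simp only [h, encodek, Option.bind_some, Option.map_some, Option.mem_def]
      rw [hlist, Option.bind_some]⟩ :
    (M.eval (a ++ (b ++ (c ++ d))) (encode i)).Dom)
  refine ⟨v, hv, ?_⟩
  obtain ⟨N, hN⟩ := Nat.rfindOpt_spec hv
  obtain ⟨k', a', b', c', d', L', j, hL', hj, rfl⟩ := hspec hN
  obtain rfl : i = j := by simpa using hj
  obtain ⟨-, rfl, rfl, rfl, rfl⟩ := hunique (t := []) hlist (by rwa [List.append_nil])
  obtain ⟨-, n', hn', z', hz', m', hm', -, -, hsel⟩ := describedList_eq_some.1 hL'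
  obtain rfl := Part.mem_unique (hsound _ _ _ _ hn') ha
  obtain rfl := Part.mem_unique (hsound _ _ _ _ hz') hb
  obtain rfl := Part.mem_unique (hsound _ _ _ _ hm') hc
  obtain ⟨hnd, hmem⟩ := select_spec (P := P)
    (fun s v hv => Part.mem_unique (hsound _ _ _ _ hv) (hd s)) hsel
  refine isApprox_uniform hnd ?_ hS i
  ext s
  simp [hmem]

end PrefixComputer

/-! ### Depth and effective complexity -/

theorem TuringMachine.depth_le_iff {V : TuringMachine} {z T : ℕ} {x : BitString} :
    V.depth z x ≤ T ↔
      ∃ (p : BitString) (t : ℕ), p.length ≤ V.plainK x + z ∧ V.HaltsWith p t x ∧ t ≤ T := by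
  constructor
  · intro h
    have hne : V.depth z x < ⊤ := h.trans_lt (ENat.natCast_lt_top T)
    obtain ⟨u, hu, -⟩ := sInf_lt_iff.1 hne
    obtain ⟨p, t, hp, ht, heq⟩ := csInf_mem (⟨u, hu⟩ : Set.Nonempty _)
    exact ⟨p, t, hp, ht, by
      rw [TuringMachine.depth, heq] at h
      exact_mod_cast h⟩
  · rintro ⟨p, t, hp, ht, htT⟩
    exact (sInf_le ⟨p, t, hp, ht, rfl⟩ : V.depth z x ≤ t).trans (by exact_mod_cast htT)

theorem mainTheorem2 (V : TuringMachine) (hV : V.IsUniversal)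
    (U : PrefixComputer) (hU : U.IsUniversal) :
    ∃ ω : ℕ, ∀ f : ℕ → ℕ, StrictMono f → Computable f →
      ∀ (k : ℕ) (x : BitString), IsWellBehaved V U k x →
      ∀ 𝒞 : Set Ensemble, IsDecidableConstraint 𝒞 → IsConvexConstraint 𝒞 → dirac x ∈ 𝒞 →
      ∀ (δ Δ : ℝ) (z : ℕ), 0 ≤ δ →
        ((k + z + U.K z + U.Kfun f + ω + 1 + U.Kconstraint 𝒞 : ℕ) : ℝ) ≤ Δ →
        ((U.K (V.plainK x) + U.K z + U.Kfun f + U.Kconstraint 𝒞 + ω : ℕ) : ℕ∞)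
          < U.effComplexity δ Δ x 𝒞 →
        (f (V.plainK x) : ℕ∞) < V.depth z x := by
  classical
  obtain ⟨M, hM⟩ := U.exists_uniformEnsemble_computer V
  obtain ⟨ω, hω⟩ := hU M
  refine ⟨ω, fun f _ hf k x hx 𝒞 hdec hconv hmem δ Δ z hδ hΔ heff => ?_⟩
  by_contra! hdepth
  -- If `x` is shallow, it is one of the outputs within time `f (C(x))` of the programs of length at
  -- most `C(x) + z`; the uniform ensemble on those that satisfy the constraint is then admissible.
  obtain ⟨p, t, hp, hhalt, htf⟩ := TuringMachine.depth_le_iff.1 hdepth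
  set n := V.plainK x
  have hdec' : Computable fun s : BitString => decide (dirac s ∈ 𝒞) := by
    obtain ⟨_, h⟩ := hdec
    exact h.of_eq fun s => by congr
  obtain ⟨a, ha, hae⟩ := hU.exists_length_eq_K n
  obtain ⟨b, hb, hbe⟩ := hU.exists_length_eq_K z
  obtain ⟨c, hc, hce⟩ := hU.exists_length_eq_Kfun hf
  obtain ⟨d, hd, hde⟩ := hU.exists_length_eq_Kfun hdec'
  have hd' : d.length = U.Kconstraint 𝒞 := by rw [hd, PrefixComputer.Kconstraint]
  set S := (V.outputsWithin (n + z) (f n)).toFinset.filter fun s => dirac s ∈ 𝒞 with hSdef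
  have hxS : x ∈ S := by
    rw [hSdef, Finset.mem_filter, List.mem_toFinset]
    exact ⟨List.mem_map.2 ⟨p, mem_stringsUpTo hp, hhalt.outputWithin_eq htf⟩, hmem⟩
  have hS : S.Nonempty := ⟨x, hxS⟩
  have hKens : U.Kens (uniformEnsemble S hS) ≤
      U.K n + U.K z + U.Kfun f + U.Kconstraint 𝒞 + ω := by
    obtain ⟨q, hq, hqe⟩ := hω (a ++ (b ++ (c ++ d)))
    have hle : U.Kens (uniformEnsemble S hS) ≤ q.length := by
      refine Nat.sInf_le ⟨q, rfl, fun i => ?_⟩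
      obtain ⟨v, hv, happrox⟩ := hM a b c d n z (f n) (fun s => dirac s ∈ 𝒞) hae hbe (hce n) hde hS i
      exact ⟨v, hqe _ _ hv, happrox⟩
    simp only [List.length_append] at hq
    omega
  have hcard : S.card ≤ 2 ^ (n + z + 1) := by
    have h1 : S.card ≤ (stringsUpTo (n + z)).length :=
      (Finset.card_filter_le _ _).trans ((List.toFinset_card_le _).trans
        (List.length_map _).le)
    have h2 := length_stringsUpTo (n + z)
    omega
  have hentropy : entropy (uniformEnsemble S hS).toPMF ≤ n + z + 1 := by
    have hpos : (0 : ℝ) < S.card := by exact_mod_cast hS.card_pos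
    rw [uniformEnsemble, entropy_uniform, Real.logb_le_iff_le_rpow (by norm_num) hpos]
    exact_mod_cast hcard
  have hinfo : U.totalInfo (uniformEnsemble S hS) ≤ U.K x + Δ := by
    have hx' : ((n + U.K n : ℕ) : ℝ) ≤ ((U.K x + k : ℕ) : ℝ) := Nat.cast_le.2 hx
    have hK : (U.Kens (uniformEnsemble S hS) : ℝ) ≤
      ((U.K n + U.K z + U.Kfun f + U.Kconstraint 𝒞 + ω : ℕ) : ℝ) := Nat.cast_le.2 hKens
    push_cast at hx' hK hΔ
    unfold PrefixComputer.totalInfo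
    linarith
  have hle : U.effComplexity δ Δ x 𝒞 ≤ (U.Kens (uniformEnsemble S hS) : ℕ∞) :=
    sInf_le ⟨_, uniformEnsemble_mem hconv S hS fun s hs => (Finset.mem_filter.1 hs).2,
      uniformEnsemble_isTypical hδ S hS hxS, hinfo, rfl⟩
  exact (heff.trans_le hle).not_ge (by exact_mod_cast hKens)
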